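/- Let $G=(V,E)$ be a finite simple graph. Its cycle matroid $M(G)$ has ground set $E$, and its bases are the maximal sets of edges that contain no cycle; $\operatorname{rank}(A)$ denotes the rank in $M(G)$ of $A\subseteq E$. The density of a nonempty set $A\subseteq E$ is $\rho(A)=|A|/\operatorname{rank}(A)$, and $\rho(G)=\rho(E)$. The graph $G$ is uniformly dense if $\rho(A)\le\rho(G)$ for every nonempty $A\subseteq E$. Let $\Delta(G)$ be the maximum degree of $G$; if $E=\emptyset$, put $\rho(G)/\Delta(G)=0$. Let $c(H)$ be the number of connected components of a graph $H$, and let $G-U$ be the subgraph of $G$ induced on $V\setminus U$. For a real number $t\ge 0$, the graph $G$ is $t$-tough if removing any $k$ vertices increases the number of components by at most $k/t$, that is, $$t\,\bigl(c(G-U)-c(G)\bigr)\le |U|\quad\text{for all } U\subseteq V .$$ It is strictly $t$-tough if $t\, c(G-U)\le |U|$ for every $U\subseteq V$ with $c(G-U)>1$. (A connected graph that is strictly $t$-tough is $t$-tough.) Theorem. Let $G$ be a uniformly dense graph. 1. $G$ is $(\rho(G)/\Delta(G))$-tough. If $G$ is connected, then it is moreover strictly $(\rho(G)/\Delta(G))$-tough.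 2. If $G$ is connected and regular, then it is $1$-tough, and moreover strictly $1$-tough. -/

import Mathlib

namespace Matroid

/-- The density `|A| / rank A` of a set `A` of elements of a matroid.  It is used for nonempty sets
of elements of finite matroids without loops, where `rank A` is a positive integer. -/
noncomputable def density {α : Type*} (M : Matroid α) (A : Set α) : ℝ :=
  (A.ncard : ℝ) / ((M.eRk A).toNat : ℝ)

/-- A (finite, loopless) matroid is uniformly dense if no nonempty set of elements has a larger
density than the whole ground set. -/
def IsUniformlyDense {α : Type*} (M : Matroid α) : Prop :=
  ∀ A : Set α, A ⊆ M.E → A.Nonempty → M.density A ≤ M.density M.E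

end Matroid

namespace SimpleGraph

theorem isAcyclic_sup_of_adj_reachable {V : Type*} {I J : SimpleGraph V} (hJ : J.IsAcyclic)
    (hJI : ∀ u v, J.Adj u v → I.Reachable u v) (K : Set (Sym2 V)) (hK : K.Finite)
    (hdisj : Disjoint K I.edgeSet) (hIK : (I ⊔ fromEdgeSet K).IsAcyclic) :
    (J ⊔ fromEdgeSet K).IsAcyclic := by
  induction K, hK using Set.Finite.induction_on with
  | empty => simpa using hJ
  | @insert e K he _ ih =>
    have hdisj' : Disjoint K I.edgeSet := hdisj.mono_left (Set.subset_insert _ _)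
    have heI : e ∉ I.edgeSet := Set.disjoint_left.1 hdisj (Set.mem_insert _ _)
    have hac : (I ⊔ fromEdgeSet K).IsAcyclic :=
      hIK.anti (sup_le_sup_left (fromEdgeSet_mono (Set.subset_insert _ _)) _)
    induction e with
    | _ u v =>
      have hsplit : ∀ H : SimpleGraph V,
          H ⊔ fromEdgeSet (insert s(u, v) K) = (H ⊔ fromEdgeSet K) ⊔ edge u v := by
        intro H
        rw [Set.insert_eq, fromEdgeSet_union, sup_comm (fromEdgeSet _), ← sup_assoc]
        rfl
      rw [hsplit] at hIK ⊢
      rw [isAcyclic_sup_fromEdgeSet_iff] at hIK ⊢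
      refine ⟨ih hdisj' hac, fun hr => ?_⟩
      have hr' : (I ⊔ fromEdgeSet K).Reachable u v := by
        obtain ⟨p⟩ := hr
        clear hIK heI hsplit hdisj he
        induction p with
        | nil => exact Reachable.refl _
        | cons h _ ihp =>
          refine Reachable.trans ?_ ihp
          rcases h with h | h
          · exact (hJI _ _ h).mono le_sup_left
          · exact Adj.reachable (Or.inr h)
      rcases hIK.2 hr' with h | h
      · exact Or.inl h
      · rcases h with h | h
        · exact absurd h heI
        · exact absurd ((fromEdgeSet_adj _).1 h).1 he

theorem exists_adj_not_reachable_of_card_lt {V : Type*} [Finite V] {I J : SimpleGraph V}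
    (hI : I.IsAcyclic) (hJ : J.IsAcyclic) (hlt : I.edgeSet.ncard < J.edgeSet.ncard) :
    ∃ u v, J.Adj u v ∧ ¬ I.Reachable u v := by
  by_contra hcon
  push Not at hcon
  have hne : Nonempty V := by
    obtain ⟨e, -⟩ := Set.nonempty_of_ncard_ne_zero (by omega : J.edgeSet.ncard ≠ 0)
    exact ⟨e.out.1⟩
  obtain ⟨T, hIT, -, hT⟩ :=
    (connected_top (V := V)).exists_isTree_le_of_le_of_isAcyclic (le_top : I ≤ ⊤) hI
  have hsub : I.edgeSet ⊆ T.edgeSet := edgeSet_mono hIT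
  have hK : I ⊔ fromEdgeSet (T.edgeSet \ I.edgeSet) = T := by
    rw [fromEdgeSet_sdiff, fromEdgeSet_edgeSet, fromEdgeSet_edgeSet]
    exact sup_sdiff_cancel_right hIT
  have hJK := isAcyclic_sup_of_adj_reachable hJ hcon (T.edgeSet \ I.edgeSet) (Set.toFinite _)
    Set.disjoint_sdiff_left (by rw [hK]; exact hT.isAcyclic)
  obtain ⟨S, hJS, -, hS⟩ :=
    (connected_top (V := V)).exists_isTree_le_of_le_of_isAcyclic le_top hJK
  have hdisj : Disjoint J.edgeSet (T.edgeSet \ I.edgeSet) := by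
    refine Set.disjoint_left.2 fun e heJ heT => ?_
    induction e with
    | _ u v =>
      have h := isAcyclic_iff_forall_isBridge.1 hT.isAcyclic heT.1
      rw [isBridge_iff] at h
      refine h ((hcon u v heJ).mono ?_)
      rw [← edgeSet_subset_edgeSet, edgeSet_deleteEdges]
      intro f hf
      exact ⟨hsub hf, fun hfe => heT.2 (hfe ▸ hf)⟩
  have hsub2 : J.edgeSet ∪ (T.edgeSet \ I.edgeSet) ⊆ S.edgeSet := by
    refine Set.union_subset (edgeSet_mono (le_sup_left.trans hJS)) fun e he => ?_
    refine edgeSet_mono (le_sup_right.trans hJS) ?_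
    rw [edgeSet_fromEdgeSet]
    exact ⟨he, T.not_isDiag_of_mem_edgeSet he.1⟩
  have h1 := Set.ncard_le_ncard hsub2 (Set.toFinite _)
  rw [Set.ncard_union_eq hdisj (Set.toFinite _) (Set.toFinite _)] at h1
  have h2 := Set.ncard_sdiff_add_ncard_of_subset hsub (Set.toFinite _)
  have h3 := (isTree_iff_connected_and_card.1 hT).2
  have h4 := (isTree_iff_connected_and_card.1 hS).2
  rw [Nat.card_coe_set_eq] at h3 h4
  omega

/-- The cycle matroid of a finite simple graph: the elements are the edges, and a set of edges is
independent if it contains no cycle. -/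
def cycleMatroid {V : Type*} [Finite V] (G : SimpleGraph V) : Matroid (Sym2 V) :=
  (IndepMatroid.ofFinite (E := G.edgeSet) (Set.toFinite _)
    (fun I => I ⊆ G.edgeSet ∧ (fromEdgeSet I).IsAcyclic)
    (by simp)
    (fun _ _ hJ hIJ => ⟨hIJ.trans hJ.1, hJ.2.anti (fromEdgeSet_mono hIJ)⟩)
    (fun I J hI hJ hlt => by
      have hE : ∀ A : Set (Sym2 V), A ⊆ G.edgeSet → (fromEdgeSet A).edgeSet = A := by
        intro A hA
        rw [edgeSet_fromEdgeSet]
        exact sdiff_eq_left.2 (Set.disjoint_left.2 fun e he =>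
          G.not_isDiag_of_mem_edgeSet (hA he))
      obtain ⟨u, v, hadj, hr⟩ := exists_adj_not_reachable_of_card_lt hI.2 hJ.2
        (by rwa [hE I hI.1, hE J hJ.1])
      have huv := (fromEdgeSet_adj _).1 hadj
      refine ⟨s(u, v), huv.1, fun h => hr (Adj.reachable ((fromEdgeSet_adj _).2 ⟨h, huv.2⟩)),
        Set.insert_subset (hJ.1 huv.1) hI.1, ?_⟩
      rw [Set.insert_eq, fromEdgeSet_union, sup_comm]
      exact hI.2.sup_edge_of_not_reachable hr)
    (fun _ hI => hI.1)).matroid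

/-- The bases of the cycle matroid are the maximal sets of edges that contain no cycle. -/
theorem cycleMatroid_isBase_iff {V : Type*} [Finite V] (G : SimpleGraph V) (T : Set (Sym2 V)) :
    G.cycleMatroid.IsBase T ↔
      Maximal (fun I => I ⊆ G.edgeSet ∧ (fromEdgeSet I).IsAcyclic) T :=
  Matroid.isBase_iff_maximal_indep

/-- A graph is uniformly dense if its cycle matroid is. -/
def IsUniformlyDense {V : Type*} [Finite V] (G : SimpleGraph V) : Prop :=
  G.cycleMatroid.IsUniformlyDense

/-- The density `ρ(G) = |E| / rank(E)` of a graph. -/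
noncomputable def rho {V : Type*} [Finite V] (G : SimpleGraph V) : ℝ :=
  G.cycleMatroid.density G.cycleMatroid.E

/-- The number of connected components of a graph. -/
noncomputable def numComponents {V : Type*} (G : SimpleGraph V) : ℕ :=
  Nat.card G.ConnectedComponent

/-- The number of connected components after the vertices in `U` have been removed. -/
noncomputable def numComponentsRemove {V : Type*} (G : SimpleGraph V) (U : Finset V) : ℕ :=
  (G.induce ((U : Set V)ᶜ)).numComponents

/-- `G` is `t`-tough: removing any `k` vertices increases the number of components by at
most `k / t` (written without division, so that every graph is `0`-tough). -/
def IsTough {V : Type*} (G : SimpleGraph V) (t : ℝ) : Prop :=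
  ∀ U : Finset V,
    t * ((G.numComponentsRemove U : ℝ) - (G.numComponents : ℝ)) ≤ (U.card : ℝ)

/-- The stricter notion of `t`-toughness: removing `k` vertices leaves at most `k / t` components
whenever it leaves more than one. -/
def IsStrictlyTough {V : Type*} (G : SimpleGraph V) (t : ℝ) : Prop :=
  ∀ U : Finset V, 1 < G.numComponentsRemove U →
    t * (G.numComponentsRemove U : ℝ) ≤ (U.card : ℝ)

end SimpleGraph

namespace SimpleGraph

variable {V : Type*}

/-! Let `A` be the set of edges of G - U. Every lost edge meets U, so |E| - |A| ≤ Δ|U|. Uniform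
density gives |A| ≤ ρ rank(A), while |E| = ρ rank(E), hence ρ(rank(E) - rank(A)) ≤ Δ|U|. Rank is |V|
minus the number of components, and on all of V the edges `A` leave U isolated, so the rank drops by
at least c(G-U) - c(G) + |U|. This gives `rho_mul_le`. Part 1 discards |U|, or |U| - c(G) ≥ 0 when G
is connected and U nonempty. In part 2, d-regularity gives ρ = nd/(2(n-1)) > d/2, so c(G-U) > |U|
would contradict the same inequality. -/

/-! ### Rank and number of components -/

/-- A finite forest has as many edges as vertices minus components. -/
theorem IsAcyclic.ncard_edgeSet_add_numComponents [Finite V] {F : SimpleGraph V}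
    (hF : F.IsAcyclic) : F.edgeSet.ncard + F.numComponents = Nat.card V := by
  classical
  have := Fintype.ofFinite V
  -- Handshake on each component, a tree that contains all `F`-neighbours of its vertices.
  have hcomp (c : F.ConnectedComponent) :
      ∑ v : {v // F.connectedComponentMk v = c}, F.degree v + 2 =
        2 * Fintype.card {v // F.connectedComponentMk v = c} := by
    have htree : (F.induce c.supp).IsTree := hF.isTree_connectedComponent c
    have hcard := htree.card_edgeFinset
    have hsum := (F.induce c.supp).sum_degrees_eq_twice_card_edges
    have hdeg (v : c.supp) : (F.induce c.supp).degree v = F.degree v :=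
      degree_induce_of_neighborSet_subset fun w hw => c.mem_supp_of_adj_mem_supp v.2 hw
    simp only [hdeg] at hsum
    have hsupp : ∑ v : c.supp, F.degree v + 2 = 2 * Fintype.card c.supp := by omega
    convert hsupp <;> exact ConnectedComponent.mem_supp_iff _ _
  have hdeg : ∑ v, F.degree v + 2 * Fintype.card F.ConnectedComponent = 2 * Fintype.card V := by
    rw [← Fintype.sum_fiberwise F.connectedComponentMk, ← Fintype.card_congr
      (Equiv.sigmaFiberEquiv F.connectedComponentMk), Fintype.card_sigma, Finset.mul_sum,
      mul_comm, ← smul_eq_mul, ← Finset.card_univ, ← Finset.sum_const, ← Finset.sum_add_distrib]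
    exact Finset.sum_congr rfl fun c _ => hcomp c
  rw [sum_degrees_eq_twice_card_edges, ← Nat.card_eq_fintype_card (α := F.ConnectedComponent),
    ← Nat.card_eq_fintype_card (α := V)] at hdeg
  have hncard : F.edgeSet.ncard = F.edgeFinset.card := by
    rw [← coe_edgeFinset, Set.ncard_coe_finset]
  unfold numComponents
  omega

theorem numComponents_eq_of_reachable_eq {G H : SimpleGraph V} (h : G.Reachable = H.Reachable) :
    G.numComponents = H.numComponents :=
  Nat.card_congr (Quot.congrRight fun u v => by rw [h])

/-- The rank of the edge set of a subgraph in the cycle matroid. -/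
theorem eRk_cycleMatroid_add_numComponents [Finite V] {G H : SimpleGraph V} (hHG : H ≤ G) :
    (G.cycleMatroid.eRk H.edgeSet).toNat + H.numComponents = Nat.card V := by
  obtain ⟨F, -, hF⟩ := H.exists_maximal_isAcyclic_of_le_isAcyclic bot_le isAcyclic_bot
  -- A maximal forest `F` of `H` is a basis of its edge set and has the same components as `H`.
  have hbasis : G.cycleMatroid.IsBasis F.edgeSet H.edgeSet := by
    refine ⟨⟨⟨⟨edgeSet_mono (hF.prop.1.trans hHG), ?_⟩, edgeSet_mono hF.prop.1⟩, ?_⟩,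
      edgeSet_mono hHG⟩
    · simpa using hF.prop.2
    · rintro J ⟨hJ, hJH⟩ hFJ
      have hle : fromEdgeSet J ≤ F := by
        refine hF.le_of_ge ⟨?_, hJ.2⟩ ?_
        · simpa using fromEdgeSet_mono hJH
        · simpa using fromEdgeSet_mono hFJ
      intro e he
      refine edgeSet_mono hle ?_
      rw [edgeSet_fromEdgeSet]
      exact ⟨he, H.not_isDiag_of_mem_edgeSet (hJH he)⟩
  rw [hbasis.eRk_eq_encard, ← numComponents_eq_of_reachable_eq
    (reachable_eq_of_maximal_isAcyclic F hF)]
  exact hF.prop.2.ncard_edgeSet_add_numComponents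

/-! ### Effect of removing vertices -/

/-- Isolating the vertices of `U` yields at least `|U|` components more than removing them. -/
theorem card_add_numComponentsRemove_le [Finite V] (G : SimpleGraph V) (U : Finset V) :
    U.card + G.numComponentsRemove U ≤
      (G.induce ((U : Set V)ᶜ)).spanningCoe.numComponents := by
  classical
  let K := G.induce ((U : Set V)ᶜ)
  -- Constant along walks, since no edge touches `U`; it therefore descends to a surjection from the
  -- components.
  let f (v : V) : U ⊕ K.ConnectedComponent :=
    if hv : v ∈ U then Sum.inl ⟨v, hv⟩ else Sum.inr (K.connectedComponentMk ⟨v, by simpa using hv⟩)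
  have hf {u v : V} (p : K.spanningCoe.Walk u v) : f u = f v := by
    induction p with
    | nil => rfl
    | cons h _ ih =>
      rw [← ih]
      obtain ⟨-, a, b, hab, rfl, rfl⟩ := h
      have ha : (a : V) ∉ U := a.2
      have hb : (b : V) ∉ U := b.2
      simp only [f, Function.Embedding.subtype_apply, dif_neg ha, dif_neg hb]
      exact congrArg Sum.inr (ConnectedComponent.sound hab.reachable)
  have hsurj : Function.Surjective
      (ConnectedComponent.lift (G := K.spanningCoe) f fun _ _ p _ => hf p) := by
    rintro (u | c)
    · exact ⟨K.spanningCoe.connectedComponentMk u, by simp [f]⟩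
    · induction c using ConnectedComponent.ind with
      | _ v =>
        have hv : (v : V) ∉ U := v.2
        exact ⟨K.spanningCoe.connectedComponentMk v, by simp [f, hv]⟩
  have h := Nat.card_le_card_of_surjective _ hsurj
  rw [Nat.card_sum] at h
  simpa [numComponentsRemove, numComponents, K] using h

/-- Each lost edge is incident to a vertex of `U`; a union bound over `U` suffices. -/
theorem ncard_edgeSet_le_add_maxDegree_mul [Fintype V] (G : SimpleGraph V) [DecidableRel G.Adj]
    (U : Finset V) :
    G.edgeSet.ncard ≤ (G.induce ((U : Set V)ᶜ)).spanningCoe.edgeSet.ncard +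
      G.maxDegree * U.card := by
  classical
  have hsub : G.edgeSet ⊆ (G.induce ((U : Set V)ᶜ)).spanningCoe.edgeSet ∪
      (U.biUnion fun u => G.incidenceFinset u : Finset (Sym2 V)) := by
    intro e he
    by_cases h : ∃ u ∈ U, u ∈ e
    · obtain ⟨u, hu, hue⟩ := h
      refine Or.inr ?_
      simp only [Finset.mem_coe, Finset.mem_biUnion, mem_incidenceFinset]
      exact ⟨u, hu, he, hue⟩
    · refine Or.inl ?_
      push Not at h
      induction e with
      | _ a b =>
        have ha : a ∉ U := fun ha => h a ha (Sym2.mem_mk_left a b)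
        have hb : b ∉ U := fun hb => h b hb (Sym2.mem_mk_right a b)
        exact ⟨G.ne_of_adj he, ⟨a, by simpa using ha⟩, ⟨b, by simpa using hb⟩, he, rfl, rfl⟩
  refine (Set.ncard_le_ncard hsub (Set.toFinite _)).trans ((Set.ncard_union_le _ _).trans ?_)
  rw [Set.ncard_coe_finset]
  gcongr
  rw [mul_comm]
  refine Finset.card_biUnion_le_card_mul _ _ _ fun u _ => ?_
  rw [card_incidenceFinset_eq_degree]
  exact G.degree_le_maxDegree u

theorem numComponents_le_card [Finite V] (G : SimpleGraph V) : G.numComponents ≤ Nat.card V :=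
  Nat.card_le_card_of_surjective G.connectedComponentMk Quot.mk_surjective

theorem Connected.numComponents_eq_one {G : SimpleGraph V} (hG : G.Connected) :
    G.numComponents = 1 := by
  have := hG.preconnected.subsingleton_connectedComponent
  have := hG.nonempty
  exact Nat.card_eq_one_iff_unique.2 ⟨inferInstance, inferInstance⟩

/-! ### Density and the basic inequality -/

theorem rho_nonneg [Finite V] (G : SimpleGraph V) : 0 ≤ G.rho := by
  unfold rho Matroid.density
  positivity

theorem numComponents_add_rank [Finite V] (G : SimpleGraph V) :
    ((G.cycleMatroid.eRk G.edgeSet).toNat : ℝ) + G.numComponents = Nat.card V := by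
  exact_mod_cast eRk_cycleMatroid_add_numComponents (le_refl G)

/-- The rank of a nonempty edge set of a simple graph is positive. -/
theorem rank_pos_of_nonempty [Finite V] {G : SimpleGraph V} {A : Set (Sym2 V)}
    (hA : A ⊆ G.edgeSet) (hne : A.Nonempty) : 0 < (G.cycleMatroid.eRk A).toNat := by
  obtain ⟨e, he⟩ := hne
  have hind : G.cycleMatroid.Indep {e} := by
    refine ⟨Set.singleton_subset_iff.2 (hA he), ?_⟩
    induction e with
    | _ a b =>
      have h : (⊥ ⊔ edge a b : SimpleGraph V).IsAcyclic :=
        isAcyclic_bot.sup_edge_of_not_reachable fun h =>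
          (G.mem_edgeSet.1 (hA he)).ne (reachable_bot.1 h)
      rwa [bot_sup_eq] at h
  have h := hind.encard_le_eRk_of_subset (Set.singleton_subset_iff.2 he)
  have htop : G.cycleMatroid.eRk A ≠ ⊤ :=
    ne_top_of_le_ne_top (Set.encard_ne_top_iff.2 A.toFinite) (Matroid.eRk_le_encard _ _)
  rw [Set.encard_singleton, ← ENat.natCast_toNat htop] at h
  exact_mod_cast h

/-- The edges of a uniformly dense graph satisfy `|A| ≤ ρ(G) rank(A)`. -/
theorem IsUniformlyDense.ncard_le [Finite V] {G : SimpleGraph V} (hG : G.IsUniformlyDense)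
    {A : Set (Sym2 V)} (hA : A ⊆ G.edgeSet) :
    (A.ncard : ℝ) ≤ G.rho * (G.cycleMatroid.eRk A).toNat := by
  rcases A.eq_empty_or_nonempty with rfl | hne
  · simp
  · have hpos : (0 : ℝ) < (G.cycleMatroid.eRk A).toNat := by
      exact_mod_cast rank_pos_of_nonempty hA hne
    exact (div_le_iff₀ hpos).1 (hG A hA hne)

theorem rho_mul_rank [Finite V] (G : SimpleGraph V) :
    G.rho * (G.cycleMatroid.eRk G.edgeSet).toNat = G.edgeSet.ncard := by
  rcases G.edgeSet.eq_empty_or_nonempty with h | hne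
  · simp [h]
  · have hpos : (0 : ℝ) < (G.cycleMatroid.eRk G.edgeSet).toNat := by
      exact_mod_cast rank_pos_of_nonempty subset_rfl hne
    exact div_mul_cancel₀ _ hpos.ne'

/-- The basic inequality behind the toughness of uniformly dense graphs. -/
theorem IsUniformlyDense.rho_mul_le [Fintype V] {G : SimpleGraph V} [DecidableRel G.Adj]
    (hG : G.IsUniformlyDense) (U : Finset V) :
    G.rho * ((G.numComponentsRemove U : ℝ) - G.numComponents + U.card) ≤
      G.maxDegree * U.card := by
  have hle : (G.induce ((U : Set V)ᶜ)).spanningCoe ≤ G := spanningCoe_induce_le G _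
  have hA := hG.ncard_le (edgeSet_mono hle)
  have hE := G.rho_mul_rank
  have hr := G.numComponents_add_rank
  have hrank : (((G.cycleMatroid.eRk (G.induce ((U : Set V)ᶜ)).spanningCoe.edgeSet).toNat : ℝ) +
      (G.induce ((U : Set V)ᶜ)).spanningCoe.numComponents) = Nat.card V := by
    exact_mod_cast eRk_cycleMatroid_add_numComponents hle
  have hc : (U.card : ℝ) + G.numComponentsRemove U ≤
      (G.induce ((U : Set V)ᶜ)).spanningCoe.numComponents := by
    exact_mod_cast card_add_numComponentsRemove_le G U
  have hd : (G.edgeSet.ncard : ℝ) ≤ (G.induce ((U : Set V)ᶜ)).spanningCoe.edgeSet.ncard +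
      G.maxDegree * U.card := by
    exact_mod_cast ncard_edgeSet_le_add_maxDegree_mul G U
  have hmul : G.rho * ((G.numComponentsRemove U : ℝ) - G.numComponents + U.card) ≤
      G.rho * ((G.cycleMatroid.eRk G.edgeSet).toNat -
        (G.cycleMatroid.eRk (G.induce ((U : Set V)ᶜ)).spanningCoe.edgeSet).toNat) :=
    mul_le_mul_of_nonneg_left (by linarith) G.rho_nonneg
  rw [mul_sub] at hmul
  linarith

/-! ### Toughness -/

theorem div_mul_le_of_mul_le_mul {a b x y : ℝ} (hb : 0 ≤ b) (hy : 0 ≤ y) (h : a * x ≤ b * y) :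
    a / b * x ≤ y := by
  -- For `b = 0` the quotient is 0 by convention; this covers edgeless graphs, where the maximum
  -- degree is 0.
  rcases hb.eq_or_lt with rfl | hb
  · simpa
  · rw [div_mul_eq_mul_div, div_le_iff₀ hb]
    linarith

/-- Removing no vertex from a connected graph leaves one component. -/
theorem Connected.card_pos_of_one_lt_numComponentsRemove {G : SimpleGraph V} (hG : G.Connected)
    {U : Finset V} (hU : 1 < G.numComponentsRemove U) : 0 < U.card := by
  rw [Finset.card_pos, Finset.nonempty_iff_ne_empty]
  rintro rfl
  have hconn : (G.induce (((∅ : Finset V) : Set V)ᶜ)).Connected := by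
    rw [Finset.coe_empty, Set.compl_empty]
    exact (induceUnivIso G).connected_iff.2 hG
  have h := hconn.numComponents_eq_one
  unfold numComponentsRemove at hU
  omega

theorem IsUniformlyDense.isTough [Fintype V] {G : SimpleGraph V} [DecidableRel G.Adj]
    (hG : G.IsUniformlyDense) : G.IsTough (G.rho / G.maxDegree) := by
  intro U
  refine div_mul_le_of_mul_le_mul (Nat.cast_nonneg _) (Nat.cast_nonneg _)
    (le_trans (mul_le_mul_of_nonneg_left ?_ G.rho_nonneg) (hG.rho_mul_le U))
  linarith [(Nat.cast_nonneg U.card : (0 : ℝ) ≤ U.card)]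

theorem IsUniformlyDense.isStrictlyTough [Fintype V] {G : SimpleGraph V} [DecidableRel G.Adj]
    (hG : G.IsUniformlyDense) (hconn : G.Connected) :
    G.IsStrictlyTough (G.rho / G.maxDegree) := by
  intro U hU
  refine div_mul_le_of_mul_le_mul (Nat.cast_nonneg _) (Nat.cast_nonneg _)
    (le_trans (mul_le_mul_of_nonneg_left ?_ G.rho_nonneg) (hG.rho_mul_le U))
  have hpos : (1 : ℝ) ≤ U.card := by
    exact_mod_cast hconn.card_pos_of_one_lt_numComponentsRemove hU
  rw [hconn.numComponents_eq_one]
  push_cast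
  linarith

theorem IsUniformlyDense.isStrictlyTough_one [Fintype V] {G : SimpleGraph V} [DecidableRel G.Adj]
    (hG : G.IsUniformlyDense) (hconn : G.Connected) {d : ℕ} (hd : G.IsRegularOfDegree d) :
    G.IsStrictlyTough 1 := by
  classical
  intro U hU
  have := hconn.nonempty
  have hUpos := hconn.card_pos_of_one_lt_numComponentsRemove hU
  -- At least two vertices are needed for `d > 0`, which makes ρ > d/2 strict.
  have hcard : 1 < Nat.card V := by
    have h := (card_add_numComponentsRemove_le G U).trans (numComponents_le_card _)
    omega
  have : Nontrivial V := Finite.one_lt_card_iff_nontrivial.1 hcard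
  have hdpos : (0 : ℝ) < d := by
    have h := hconn.preconnected.degree_pos_of_nontrivial (Classical.arbitrary V)
    rw [hd.degree_eq] at h
    exact_mod_cast h
  have hedges : (2 : ℝ) * G.edgeSet.ncard = Nat.card V * d := by
    have h := G.sum_degrees_eq_twice_card_edges
    simp only [hd.degree_eq, Finset.sum_const, Finset.card_univ, smul_eq_mul] at h
    rw [← coe_edgeFinset, Set.ncard_coe_finset, Nat.card_eq_fintype_card]
    exact_mod_cast h.symm
  have hE := G.rho_mul_rank
  have hr := G.numComponents_add_rank
  have hmain := hG.rho_mul_le U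
  rw [hconn.numComponents_eq_one] at hr hmain
  rw [hd.maxDegree_eq] at hmain
  have hn : (1 : ℝ) < Nat.card V := by exact_mod_cast hcard
  push_cast at hr hmain
  have hrank : ((G.cycleMatroid.eRk G.edgeSet).toNat : ℝ) = Nat.card V - 1 := by linarith
  rw [hrank] at hE
  -- Here nd = 2ρ(n - 1) with d > 0 and n > 1.
  have hrho : (d : ℝ) < 2 * G.rho := by
    by_contra! h
    nlinarith
  by_contra! h
  have hlt : U.card + 1 ≤ G.numComponentsRemove U := by
    rw [one_mul] at h
    exact_mod_cast h
  have hlt' : (U.card : ℝ) + 1 ≤ G.numComponentsRemove U := by exact_mod_cast hlt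
  have hUpos' : (0 : ℝ) < U.card := by exact_mod_cast hUpos
  -- Contradiction: d|U| < 2ρ|U| ≤ ρ(c(G-U) - 1 + |U|) ≤ d|U|.
  have h1 := mul_lt_mul_of_pos_right hrho hUpos'
  have h2 := mul_le_mul_of_nonneg_left
    (show 2 * (U.card : ℝ) ≤ G.numComponentsRemove U - 1 + U.card by linarith) G.rho_nonneg
  linarith

/-- A connected strictly `1`-tough graph is `1`-tough. -/
theorem IsStrictlyTough.isTough_one {G : SimpleGraph V} (hG : G.IsStrictlyTough 1)
    (hconn : G.Connected) : G.IsTough 1 := by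
  intro U
  rw [hconn.numComponents_eq_one]
  have hU : (0 : ℝ) ≤ U.card := Nat.cast_nonneg _
  rcases Nat.lt_or_ge 1 (G.numComponentsRemove U) with h | h
  · have := hG U h
    push_cast
    linarith
  · have : (G.numComponentsRemove U : ℝ) ≤ 1 := by exact_mod_cast h
    push_cast
    linarith

end SimpleGraph

theorem mainTheorem2 {V : Type*} [Fintype V] (G : SimpleGraph V) [DecidableRel G.Adj]
    (hG : G.IsUniformlyDense) :
    G.IsTough (G.rho / (G.maxDegree : ℝ)) ∧
    (G.Connected → G.IsStrictlyTough (G.rho / (G.maxDegree : ℝ))) ∧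
    (G.Connected → (∃ d : ℕ, G.IsRegularOfDegree d) →
      G.IsTough 1 ∧ G.IsStrictlyTough 1) :=
  ⟨hG.isTough, hG.isStrictlyTough, fun hconn ⟨_, hd⟩ =>
    have h := hG.isStrictlyTough_one hconn hd
    ⟨h.isTough_one hconn, h⟩⟩
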